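/- Let $r \ge 0$ and let $n_1,\ldots,n_r \ge 1$ be integers. Let $G = K_{n_1}\times\cdots\times K_{n_r}$ be the Cartesian product of complete graphs: its vertices are the $r$-tuples $(j_1,\ldots,j_r)\in[n_1]\times\cdots\times[n_r]$, and two of them are adjacent when they differ in exactly one coordinate. An edge lies in direction $i$ if its two endpoints differ in their $i$-th coordinate. Let $\mathrm{Tree}(G)$ be the set of spanning trees of $G$, and for $T\in\mathrm{Tree}(G)$ let $$q^{\mathrm{dir}(T)} := \prod_{i=1}^r q_i^{|\{\text{edges of } T \text{ in direction } i\}|}.$$ Then, in the polynomial ring $\mathbb{Q}[q_1,\ldots,q_r]$, $$\begin{aligned}\sum_{T\in \mathrm{Tree}(G)} q^{\mathrm{dir}(T)} &= \frac{1}{n_1\cdots n_r}\prod_{\emptyset\neq A\subseteq[r]}\Bigl(\sum_{i\in A} q_i n_i\Bigr)^{\prod_{i\in A}(n_i-1)} \\ &= \prod_{i=1}^r q_i^{n_i-1} n_i^{n_i-2}\ \prod_{\substack{A\subseteq[r]\\ |A|\ge 2}}\Bigl(\sum_{i\in A} q_i n_i\Bigr)^{\prod_{i\in A}(n_i-1)}.\end{aligned}$$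 -/

import Mathlib

open MvPolynomial

/-- The Cartesian product of a family of graphs: two vertices are adjacent when, for some index
`i`, their `i`-th coordinates are adjacent in `G i` and all their other coordinates agree. -/
def cartesianProduct {ι : Type*} {V : ι → Type*} (G : ∀ i, SimpleGraph (V i)) :
    SimpleGraph (∀ i, V i) where
  Adj x y := ∃ i, (G i).Adj (x i) (y i) ∧ ∀ j, j ≠ i → x j = y j
  symm := ⟨fun _ _ ⟨i, h, h'⟩ => ⟨i, h.symm, fun j hj => (h' j hj).symm⟩⟩
  loopless := ⟨fun _ ⟨i, h, _⟩ => (G i).irrefl h⟩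

/-- The finite set of spanning trees of a graph on a finite vertex set; a spanning tree is a
subgraph on the whole vertex set which is a tree. -/
noncomputable def spanningTrees {V : Type*} [Finite V] (G : SimpleGraph V) :
    Finset (SimpleGraph V) :=
  (Set.toFinite {T : SimpleGraph V | T ≤ G ∧ T.IsTree}).toFinset

/-- The number of edges of `T` in direction `i`, that is, edges whose two endpoints differ in
their `i`-th coordinate. -/
noncomputable def dirCount {ι : Type*} {V : ι → Type*} (T : SimpleGraph (∀ i, V i)) (i : ι) : ℕ :=
  {e ∈ T.edgeSet | ∃ x y : ∀ i, V i, e = s(x, y) ∧ x i ≠ y i}.ncard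

/-- The direction monomial `∏ i, q_i ^ (number of edges of T in direction i)`. -/
noncomputable def dirMonomial {ι : Type*} [Fintype ι] {V : ι → Type*}
    (T : SimpleGraph (∀ i, V i)) : MvPolynomial ι ℚ :=
  ∏ i, X i ^ dirCount T i

/-!
The identity is the weighted matrix-tree theorem combined with a diagonalisation of the Laplacian.

Give an edge of `G = K_{n_1} × ⋯ × K_{n_r}` in direction `i` the weight `q_i` (`directionWeight`),
and every other pair of vertices the weight `0`. Then `q^{dir(T)}` is the product of the weights of
the edges of `T`, and trees that are not contained in `G` contribute nothing, so the left-hand side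
is the weighted sum of all trees on the vertex set (`sum_spanningTrees_dirMonomial`).

The matrix-tree theorem is proved by expanding the determinant of the Laplacian, with the row of a
root `r` replaced by a basis vector, multilinearly in its rows. The terms are indexed by functions
`f` on the vertices that fix `r`; such a term carries the determinant of `1 - N`, for `N` the matrix
of `f` off the root. This determinant is `1` if `f` leads every vertex to the root
(`IsParentFun.det_parentMatrix`) and `0` otherwise (`det_parentMatrix_of_not_isParentFun`). The
functions of the first kind are the parent functions of trees rooted at `r`, and they correspond
bijectively to trees (`det_updateRow_weightedLaplacian`). With `m` vertices and the all-ones matrix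
`J` one deduces `det (L + J) = m² ∑_T w(T)` (`det_weightedLaplacian_add_one`).

On the other hand the Laplacian `L` of the product is a Kronecker sum of the matrices `q_i L_i`,
with `L_i` the Laplacian of `K_{n_i}`. The matrix `L_i` has eigenvalue `0` on the all-ones vector
and `n_i` on the vectors `e_y - e_o`, `y ≠ o`. Tensor products of these vectors give an eigenbasis
of `L`, indexed by the vertices `y`, with eigenvalues `∑_{i : y_i ≠ o_i} q_i n_i`. The matrix `J`
only changes the eigenvalue at `y = o`, from `0` to `m`
(`det_weightedLaplacian_directionWeight`). There are `∏_{i ∈ A} (n_i - 1)` vertices `y` that differ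
from `o` exactly in the coordinates `A` (`prod_productEigenvalue`), which gives the exponents.
-/

open scoped Matrix

/-! ### Trees as parent functions -/

/-- `f` is the parent function of a tree on `V` rooted at `r`: it fixes the root, and iterating it
leads from every vertex to the root. -/
def IsParentFun {V : Type*} (r : V) (f : V → V) : Prop :=
  f r = r ∧ ∀ v, ∃ k, f^[k] v = r

/-- The graph joining every vertex to its image under `f` (whenever the two are distinct). -/
def parentGraph {V : Type*} (f : V → V) : SimpleGraph V :=
  SimpleGraph.fromRel fun x y => f x = y

namespace IsParentFun

variable {V : Type*} {r : V} {f g : V → V}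

/-- A set of vertices that a parent function maps into itself contains the root, unless it is
empty. -/
theorem notMem_of_mapsTo (hf : IsParentFun r f) {S : Set V} (hS : ∀ v ∈ S, f v ∈ S)
    (hr : r ∉ S) (v : V) : v ∉ S := by
  intro hv
  obtain ⟨k, hk⟩ := hf.2 v
  exact hr (hk ▸ Set.MapsTo.iterate (s := S) hS k hv)

theorem apply_ne (hf : IsParentFun r f) {v : V} (hv : v ≠ r) : f v ≠ v := fun h =>
  hf.notMem_of_mapsTo (S := {v}) (by simp [h]) (by simpa using hv.symm) v rfl

theorem apply_apply_ne (hf : IsParentFun r f) {v : V} (hv : v ≠ r) : f (f v) ≠ v := by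
  intro h
  by_cases h2 : f v = r
  · rw [h2, hf.1] at h
    exact hv h.symm
  · exact hf.notMem_of_mapsTo (S := {v, f v}) (by simp [h]) (by simp [hv.symm, Ne.symm h2]) v
      (by simp)

theorem injOn_edge (hf : IsParentFun r f) : Set.InjOn (fun v => s(v, f v)) {v | v ≠ r} := by
  intro a ha b hb hab
  rcases Sym2.eq_iff.1 hab with h | ⟨h1, h2⟩
  · exact h.1
  · exact absurd (by rw [h2, ← h1]) (hf.apply_apply_ne ha)

theorem edgeSet_parentGraph (hf : IsParentFun r f) :
    (parentGraph f).edgeSet = (fun v => s(v, f v)) '' {v | v ≠ r} := by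
  ext e
  induction e with
  | _ x y =>
    simp only [SimpleGraph.mem_edgeSet, parentGraph, SimpleGraph.fromRel_adj, Set.mem_image,
      Set.mem_ofPred_eq]
    constructor
    · rintro ⟨hne, h | h⟩
      · refine ⟨x, ?_, by rw [h]⟩
        rintro rfl
        exact hne (hf.1.symm.trans h)
      · refine ⟨y, ?_, by rw [h, Sym2.eq_swap]⟩
        rintro rfl
        exact hne (h.symm.trans hf.1)
    · rintro ⟨v, hv, h⟩
      rcases Sym2.eq_iff.1 h with ⟨rfl, rfl⟩ | ⟨rfl, rfl⟩
      · exact ⟨(hf.apply_ne hv).symm, Or.inl rfl⟩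
      · exact ⟨hf.apply_ne hv, Or.inr rfl⟩

theorem isTree_parentGraph [Finite V] (hf : IsParentFun r f) : (parentGraph f).IsTree := by
  have hreach : ∀ k v, f^[k] v = r → (parentGraph f).Reachable v r := by
    intro k
    induction k with
    | zero => rintro v rfl; exact .refl _
    | succ k ih =>
      intro v hv
      by_cases h : v = f v
      · exact h ▸ ih (f v) hv
      · exact SimpleGraph.Reachable.trans
          (SimpleGraph.Adj.reachable ((SimpleGraph.fromRel_adj _ _ _).2 ⟨h, Or.inl rfl⟩))
          (ih (f v) hv)
  rw [SimpleGraph.isTree_iff_connected_and_card]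
  constructor
  · have : Nonempty V := ⟨r⟩
    refine ⟨fun u v => ?_⟩
    obtain ⟨k, hk⟩ := hf.2 u
    obtain ⟨l, hl⟩ := hf.2 v
    exact (hreach k u hk).trans (hreach l v hl).symm
  · have := Fintype.ofFinite V
    rw [hf.edgeSet_parentGraph, Nat.card_image_of_injOn hf.injOn_edge, Nat.card_coe_set_eq,
      ← Set.ncard_univ, ← Set.ncard_insert_of_notMem (a := r) (by simp) (Set.toFinite _)]
    congr 1
    ext v
    simp [em]

/-- The root determines the parent function of a tree. On the set where `f` and `g` disagree, an
edge `v — g v` must be an edge `w — f w` with `w = g v`, and then `f` and `g` disagree at `w` too;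
so `g` never leaves this set. -/
theorem eq_of_parentGraph_eq (hf : IsParentFun r f) (hg : IsParentFun r g)
    (h : parentGraph f = parentGraph g) : f = g := by
  funext v
  by_contra hv
  refine hg.notMem_of_mapsTo (S := {v | f v ≠ g v}) (fun v hv hgv => ?_)
    (by simp [hf.1, hg.1]) v hv
  have hvr : v ≠ r := by
    rintro rfl
    exact hv (hf.1.trans hg.1.symm)
  have hadj : (parentGraph f).Adj v (g v) := by
    rw [h]
    exact (SimpleGraph.fromRel_adj _ _ _).2 ⟨(hg.apply_ne hvr).symm, Or.inl rfl⟩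
  rcases ((SimpleGraph.fromRel_adj _ _ _).1 hadj).2 with h1 | h1
  · exact hv h1
  · exact hg.apply_apply_ne hvr (hgv ▸ h1)

end IsParentFun

/-- Every tree comes from a parent function: send a vertex to a neighbour closer to the root. -/
theorem SimpleGraph.IsTree.exists_isParentFun {V : Type*} [Finite V] {T : SimpleGraph V}
    (hT : T.IsTree) (r : V) : ∃ f, IsParentFun r f ∧ parentGraph f = T := by
  have hstep : ∀ v, ∃ u, (v = r → u = r) ∧ (v ≠ r → T.Adj v u ∧ T.dist u r < T.dist v r) := by
    intro v
    by_cases hv : v = r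
    · exact ⟨r, fun _ => rfl, fun h => absurd hv h⟩
    · obtain ⟨p, hp⟩ := hT.1.exists_walk_length_eq_dist v r
      cases p with
      | nil => exact absurd rfl hv
      | cons hadj q =>
        refine ⟨_, fun h => absurd h hv, fun _ => ⟨hadj, ?_⟩⟩
        have := SimpleGraph.dist_le q
        rw [SimpleGraph.Walk.length_cons] at hp
        omega
  choose f hfr hf using hstep
  have hpar : IsParentFun r f := by
    refine ⟨hfr r rfl, fun v => ?_⟩
    induction hd : T.dist v r using Nat.strong_induction_on generalizing v with
    | _ d ih =>
      by_cases hv : v = r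
      · exact ⟨0, hv⟩
      · obtain ⟨k, hk⟩ := ih _ (hd ▸ (hf v hv).2) (f v) rfl
        exact ⟨k + 1, hk⟩
  refine ⟨f, hpar, ?_⟩
  have hle : parentGraph f ≤ T := by
    intro x y hxy
    obtain ⟨hne, h | h⟩ := (SimpleGraph.fromRel_adj _ _ _).1 hxy
    · have hx : x ≠ r := fun hx => hne (by rw [← h, hfr x hx, hx])
      exact h ▸ (hf x hx).1
    · have hy : y ≠ r := fun hy => hne (by rw [← h, hfr y hy, hy])
      exact h ▸ (hf y hy).1.symm
  have hmin := SimpleGraph.isTree_iff_minimal_connected.1 hT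
  exact (hmin.eq_of_ge hpar.isTree_parentGraph.1 hle).symm

/-! ### The weighted matrix-tree theorem -/

/-- The matrix `1 - N`, where row `i ≠ r` of `N` is the basis vector of `f i` and row `r` of `N`
is zero. -/
def parentMatrix {V : Type*} [DecidableEq V] (R : Type*) [CommRing R] (r : V) (f : V → V) :
    Matrix V V R :=
  Matrix.of fun i => if i = r then Pi.single r 1 else Pi.single i 1 - Pi.single (f i) 1

/-- Ordered by the distance to the root, the matrix is unitriangular. -/
theorem IsParentFun.det_parentMatrix {V : Type*} [DecidableEq V] [Fintype V] {R : Type*}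
    [CommRing R] {r : V} {f : V → V} (hf : IsParentFun r f) : (parentMatrix R r f).det = 1 := by
  let d : V → ℕ := fun v => Nat.find (hf.2 v)
  have hd : ∀ v, v ≠ r → d (f v) < d v := by
    intro v hv
    have hspec : f^[d v] v = r := Nat.find_spec (hf.2 v)
    have hpos : d v ≠ 0 := fun h0 => hv (by rw [h0] at hspec; exact hspec)
    obtain ⟨k, hk⟩ := Nat.exists_eq_succ_of_ne_zero hpos
    rw [hk, Function.iterate_succ_apply] at hspec
    have : d (f v) ≤ k := Nat.find_min' _ hspec
    omega
  have hentry : ∀ i j, d i ≤ d j → i ≠ j → parentMatrix R r f i j = 0 := by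
    intro i j hij hne
    by_cases hi : i = r
    · subst hi
      simp [parentMatrix, hne.symm]
    · have : j ≠ f i := by
        rintro rfl
        exact absurd (hd i hi) (not_lt.2 hij)
      simp [parentMatrix, hi, hne.symm, this]
  have hdiag : ∀ i, parentMatrix R r f i i = 1 := by
    intro i
    by_cases hi : i = r
    · simp [parentMatrix, hi]
    · simp [parentMatrix, hi, (hf.apply_ne hi).symm]
  have htri : (parentMatrix R r f).BlockTriangular (OrderDual.toDual ∘ d) := by
    intro i j hij
    refine hentry i j (le_of_lt hij) ?_
    rintro rfl
    exact lt_irrefl _ hij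
  rw [htri.det]
  refine Finset.prod_eq_one fun a _ => ?_
  have : (parentMatrix R r f).toSquareBlock (OrderDual.toDual ∘ d) a = 1 := by
    ext ⟨i, hi⟩ ⟨j, hj⟩
    simp only [Matrix.toSquareBlock_def, Matrix.of_apply, Matrix.one_apply, Subtype.mk.injEq]
    split_ifs with h
    · rw [h, hdiag]
    · have hij : d i = d j := OrderDual.toDual.injective (hi.trans hj.symm)
      exact hentry i j hij.le h
  rw [this, Matrix.det_one]

/-- The indicator function of the vertices from which iterating `f` does not lead to the root is a
nonzero vector in the kernel. -/
theorem det_parentMatrix_of_not_isParentFun {V : Type*} [DecidableEq V] [Fintype V] {R : Type*}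
    [CommRing R] [IsDomain R] {r : V} {f : V → V} (hfr : f r = r) (hf : ¬ IsParentFun r f) :
    (parentMatrix R r f).det = 0 := by
  classical
  rw [← Matrix.exists_mulVec_eq_zero_iff]
  let v : V → R := fun i => if ∃ k, f^[k] i = r then 0 else 1
  have hvr : v r = 0 := if_pos ⟨0, rfl⟩
  refine ⟨v, fun h0 => hf ⟨hfr, fun i => ?_⟩, ?_⟩
  · by_contra hi
    have : v i = 0 := congrFun h0 i
    simp [v, hi] at this
  · funext i
    by_cases hi : i = r
    · simp [Matrix.mulVec, parentMatrix, hi, hvr]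
    · have hiff : (∃ k, f^[k] i = r) ↔ ∃ k, f^[k] (f i) = r := by
        constructor
        · rintro ⟨k, hk⟩
          refine ⟨k, ?_⟩
          rw [← Function.iterate_succ_apply, Function.iterate_succ_apply', hk, hfr]
        · rintro ⟨k, hk⟩
          exact ⟨k + 1, hk⟩
      have hrow : parentMatrix R r f i = Pi.single i 1 - Pi.single (f i) 1 := if_neg hi
      change parentMatrix R r f i ⬝ᵥ v = 0
      rw [hrow]
      simp [sub_dotProduct, v, hiff]

/-- The Laplacian matrix of the edge weights `w`. The weights of the loops cancel. -/
def weightedLaplacian {V R : Type*} [Fintype V] [DecidableEq V] [CommRing R] (w : Sym2 V → R) :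
    Matrix V V R :=
  Matrix.of fun i => ∑ j, w s(i, j) • (Pi.single i 1 - Pi.single j 1)

open Classical in
/-- The product of the weights of the edges of `T`. -/
noncomputable def edgeWeight {V R : Type*} [Fintype V] [CommRing R] (w : Sym2 V → R)
    (T : SimpleGraph V) : R :=
  ∏ e : Sym2 V with e ∈ T.edgeSet, w e

theorem IsParentFun.edgeWeight_parentGraph {V R : Type*} [Fintype V] [DecidableEq V] [CommRing R]
    (w : Sym2 V → R) {r : V} {f : V → V} (hf : IsParentFun r f) :
    edgeWeight w (parentGraph f) = ∏ v ∈ Finset.univ.erase r, w s(v, f v) := by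
  classical
  unfold edgeWeight
  rw [← Finset.prod_image (s := Finset.univ.erase r) (g := fun v => s(v, f v)) (f := w)
    (fun a ha b hb h => hf.injOn_edge (by simpa using ha) (by simpa using hb) h)]
  refine Finset.prod_congr ?_ fun _ _ => rfl
  ext e
  simp [hf.edgeSet_parentGraph]

open Classical in
/-- **Weighted matrix-tree theorem.** Expanding the determinant in its rows gives a sum over all
choices `f` of a vertex `f i` for each `i ≠ r`, in which exactly the parent functions survive. -/
theorem det_updateRow_weightedLaplacian {V R : Type*} [Fintype V] [DecidableEq V] [CommRing R]
    [IsDomain R] (w : Sym2 V → R) (r : V) :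
    ((weightedLaplacian w).updateRow r (Pi.single r 1)).det =
      ∑ T : SimpleGraph V with T.IsTree, edgeWeight w T := by
  let c : V → V → R := fun i j => if i = r then (if j = r then 1 else 0) else w s(i, j)
  let b : V → V → V → R := fun i j => if i = r then Pi.single r 1 else Pi.single i 1 - Pi.single j 1
  have hrows : (weightedLaplacian w).updateRow r (Pi.single r 1) =
      fun i => ∑ j, c i j • b i j := by
    funext i
    by_cases hi : i = r
    · subst hi
      simp [c, b]
    · rw [Matrix.updateRow_ne hi]
      simp only [c, b, if_neg hi]
      rfl
  have hterm : ∀ f : V → V, (Matrix.detRowAlternating fun i => c i (f i) • b i (f i)) =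
      if IsParentFun r f then ∏ v ∈ Finset.univ.erase r, w s(v, f v) else 0 := by
    intro f
    have h1 := (Matrix.detRowAlternating (n := V) (R := R)).toMultilinearMap.map_smul_univ
      (fun i => c i (f i)) (fun i => b i (f i))
    simp only [AlternatingMap.coe_multilinearMap] at h1
    rw [h1, ← Finset.mul_prod_erase _ _ (Finset.mem_univ r)]
    have h2 : (Matrix.detRowAlternating fun i => b i (f i)) = (parentMatrix R r f).det := rfl
    rw [h2]
    have h3 : ∏ v ∈ Finset.univ.erase r, c v (f v) = ∏ v ∈ Finset.univ.erase r, w s(v, f v) :=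
      Finset.prod_congr rfl fun v hv => by simp [c, Finset.ne_of_mem_erase hv]
    rw [h3]
    by_cases hfr : f r = r
    · split_ifs with hf
      · simp [c, hfr, hf.det_parentMatrix]
      · simp [det_parentMatrix_of_not_isParentFun hfr hf]
    · rw [if_neg fun hf => hfr hf.1]
      simp [c, hfr]
  have hexp := (Matrix.detRowAlternating (n := V) (R := R)).toMultilinearMap.map_sum
    (fun i j => c i j • b i j)
  simp only [AlternatingMap.coe_multilinearMap] at hexp
  rw [hrows]
  refine hexp.trans ?_
  simp_rw [hterm]
  rw [← Finset.sum_filter]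
  refine Finset.sum_bij (fun f _ => parentGraph f) ?_ ?_ ?_ ?_
  · intro f hf
    simpa using (Finset.mem_filter.1 hf).2.isTree_parentGraph
  · intro f hf g hg h
    exact (Finset.mem_filter.1 hf).2.eq_of_parentGraph_eq (Finset.mem_filter.1 hg).2 h
  · intro T hT
    obtain ⟨f, hf, rfl⟩ := (Finset.mem_filter.1 hT).2.exists_isParentFun r
    exact ⟨f, by simpa using hf, rfl⟩
  · intro f hf
    exact ((Finset.mem_filter.1 hf).2.edgeWeight_parentGraph w).symm

theorem weightedLaplacian_mulVec {V R : Type*} [Fintype V] [DecidableEq V] [CommRing R]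
    (w : Sym2 V → R) (v : V → R) (i : V) :
    (weightedLaplacian w).mulVec v i = ∑ j, w s(i, j) * (v i - v j) := by
  have hrow : weightedLaplacian w i = ∑ j, w s(i, j) • (Pi.single i 1 - Pi.single j 1) := rfl
  change weightedLaplacian w i ⬝ᵥ v = _
  rw [hrow]
  simp [sum_dotProduct, sub_dotProduct]

theorem sum_weightedLaplacian {V R : Type*} [Fintype V] [DecidableEq V] [CommRing R]
    (w : Sym2 V → R) (j : V) : ∑ i, weightedLaplacian w i j = 0 := by
  simp only [weightedLaplacian, Matrix.of_apply, Finset.sum_apply, Pi.smul_apply, Pi.sub_apply,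
    smul_eq_mul, mul_sub, Finset.sum_sub_distrib]
  rw [sub_eq_zero]
  conv_rhs => rw [Finset.sum_comm]
  simp only [Sym2.eq_swap]

open Classical in
/-- Adding the all-ones matrix to the Laplacian shifts the eigenvalue `0` away and leaves the other
eigenvalues alone, so this is the form of the matrix-tree theorem that suits diagonalisation. -/
theorem det_weightedLaplacian_add_one {V R : Type*} [Fintype V] [DecidableEq V] [Nonempty V]
    [CommRing R] [IsDomain R] (w : Sym2 V → R) :
    (weightedLaplacian w + Matrix.of fun _ _ => 1).det =
      (Fintype.card V : R) ^ 2 * ∑ T : SimpleGraph V with T.IsTree, edgeWeight w T := by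
  obtain ⟨r⟩ := ‹Nonempty V›
  set L := weightedLaplacian w with hL
  set J : Matrix V V R := Matrix.of fun _ _ => 1 with hJ
  set N : R := (Fintype.card V : R) with hN
  have h1 := Matrix.det_updateRow_sum (L + J) r fun _ => 1
  have hsum : ∑ k, (1 : R) • (L + J : Matrix V V R) k = N • fun _ : V => (1 : R) := by
    funext j
    rw [Finset.sum_apply]
    simp only [one_smul, Matrix.add_apply, Finset.sum_add_distrib]
    simp [hJ, hL, sum_weightedLaplacian, hN]
  rw [hsum, Matrix.det_updateRow_smul, one_smul] at h1
  -- Subtracting the row of ones from the other rows.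
  have h2 : ((L + J).updateRow r fun _ => 1).det =
      (L.updateRow r fun _ => 1).det := by
    refine Matrix.det_eq_of_forall_row_eq_smul_add_const (fun i => if i = r then 0 else 1) r
      (if_pos rfl) fun i j => ?_
    by_cases hi : i = r
    · simp [hi]
    · simp [hi, hJ]
  -- A row of coordinate sum zero makes all row sums vanish, hence also the determinant.
  have h3 : (L.updateRow r ((fun _ => 1) + (-N) • Pi.single r 1)).det = 0 := by
    rw [← Matrix.exists_mulVec_eq_zero_iff]
    refine ⟨fun _ => 1, fun h => one_ne_zero (congrFun h r), ?_⟩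
    funext i
    by_cases hi : i = r
    · subst hi
      simp [Matrix.mulVec, dotProduct, hN, Finset.sum_add_distrib, ← Finset.mul_sum]
    · have := weightedLaplacian_mulVec w (fun _ => 1) i
      simpa [Matrix.mulVec, Matrix.updateRow_ne hi] using this
  rw [Matrix.det_updateRow_add, Matrix.det_updateRow_smul, det_updateRow_weightedLaplacian] at h3
  rw [← h1, h2]
  linear_combination N * h3

/-! ### Diagonalising the Laplacian of a product of complete graphs -/

section Eigenbasis

variable {α R : Type*} [Fintype α] [DecidableEq α] [CommRing R]

/-- The columns of this matrix form an eigenbasis of the Laplacian of the complete graph on `α`: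
the column of the base point `o` is the all-ones vector, that of `y ≠ o` is `e_y - e_o`. -/
def completeEigenbasis (R : Type*) [CommRing R] (o : α) : Matrix α α R :=
  Matrix.of fun x y => if y = o then 1 else (if x = y then 1 else 0) - (if x = o then 1 else 0)

/-- The inverse of `completeEigenbasis R o`, multiplied by the cardinality of `α` to stay free of
denominators. -/
def completeEigenbasisInv (R : Type*) [CommRing R] (o : α) : Matrix α α R :=
  Matrix.of fun y x => if y = o then 1 else (Fintype.card α : R) * (if y = x then 1 else 0) - 1

theorem sum_completeEigenbasis (o y : α) :
    ∑ x, completeEigenbasis R o x y = if y = o then (Fintype.card α : R) else 0 := by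
  by_cases hy : y = o <;> simp [completeEigenbasis, hy]

theorem completeEigenbasisInv_mul_apply (o y z : α) :
    ∑ x, completeEigenbasisInv R o y x * completeEigenbasis R o x z =
      if y = z then (Fintype.card α : R) else 0 := by
  have hrow : ∀ x, completeEigenbasisInv R o y x * completeEigenbasis R o x z =
      if y = o then completeEigenbasis R o x z else
        (Fintype.card α : R) * (if y = x then completeEigenbasis R o x z else 0)
          - completeEigenbasis R o x z := by
    intro x
    by_cases hy : y = o
    · simp [completeEigenbasisInv, hy]
    · by_cases hx : y = x <;> simp [completeEigenbasisInv, hy, hx, sub_mul]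
  simp_rw [hrow]
  by_cases hy : y = o
  · simp [hy, sum_completeEigenbasis, eq_comm]
  · by_cases hz : z = o
    · simp [hy, hz, Finset.sum_sub_distrib, sum_completeEigenbasis]
      simp [completeEigenbasis]
    · simp [hy, hz, Finset.sum_sub_distrib, sum_completeEigenbasis]
      simp [completeEigenbasis, hz, hy]

/-- The column of `y` is an eigenvector of the Laplacian of the complete graph, with eigenvalue
`0` for `y = o` and `|α|` otherwise. -/
theorem sum_completeEigenbasis_sub (o x y : α) :
    ∑ a, (completeEigenbasis R o x y - completeEigenbasis R o a y) =
      (if y = o then 0 else (Fintype.card α : R)) * completeEigenbasis R o x y := by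
  rw [Finset.sum_sub_distrib, sum_completeEigenbasis]
  by_cases hy : y = o
  · simp [hy, completeEigenbasis]
  · simp [hy]

end Eigenbasis

section Product

variable {ι : Type*} {V : ι → Type*} {R : Type*} [CommRing R]

/-- The pairs of vertices that differ in the `i`-th coordinate only, that is, the edges in
direction `i` of the product of the complete graphs on the sets `V i`. -/
def directionEdges (V : ι → Type*) (i : ι) : Set (Sym2 (∀ i, V i)) :=
  {e | ∃ x y, e = s(x, y) ∧ x i ≠ y i ∧ ∀ j, j ≠ i → x j = y j}

theorem mk_mem_directionEdges {i : ι} {x y : ∀ i, V i} :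
    s(x, y) ∈ directionEdges V i ↔ x i ≠ y i ∧ ∀ j, j ≠ i → x j = y j := by
  constructor
  · rintro ⟨a, b, h, h1, h2⟩
    rcases Sym2.eq_iff.1 h with ⟨rfl, rfl⟩ | ⟨rfl, rfl⟩
    · exact ⟨h1, h2⟩
    · exact ⟨h1.symm, fun j hj => (h2 j hj).symm⟩
  · rintro ⟨h1, h2⟩
    exact ⟨x, y, rfl, h1, h2⟩

variable [Fintype ι]

open Classical in
/-- The weight `q i` on the edges in direction `i`, and `0` on all pairs that are not edges of the
product of complete graphs. -/
noncomputable def directionWeight (q : ι → R) (e : Sym2 (∀ i, V i)) : R :=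
  ∑ i, if e ∈ directionEdges V i then q i else 0

variable [DecidableEq ι] [∀ i, Fintype (V i)]

open Classical in
/-- The neighbours of `x` in direction `i` are the vertices `Function.update x i a` with
`a ≠ x i`; the value `a = x i` may be added to the sum, as its term vanishes. -/
theorem sum_directionEdges (i : ι) (x : ∀ i, V i) (g : (∀ i, V i) → R) (hg : g x = 0) :
    (∑ z, if s(x, z) ∈ directionEdges V i then g z else 0) = ∑ a, g (Function.update x i a) := by
  rw [← Finset.sum_filter]
  have himage : ∑ a, g (Function.update x i a) =
      ∑ z ∈ Finset.univ.image (Function.update x i), g z :=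
    (Finset.sum_image fun a _ b _ h => Function.update_injective x i h).symm
  rw [himage]
  refine Finset.sum_subset ?_ ?_
  · intro z hz
    obtain ⟨-, hz⟩ := mk_mem_directionEdges.1 (Finset.mem_filter.1 hz).2
    refine Finset.mem_image.2 ⟨z i, Finset.mem_univ _, ?_⟩
    rw [Function.update_eq_iff]
    exact ⟨rfl, hz⟩
  · intro z hz hz'
    obtain ⟨a, -, rfl⟩ := Finset.mem_image.1 hz
    by_cases ha : x i = a
    · rw [← ha, Function.update_eq_self, hg]
    · have hmem : s(x, Function.update x i a) ∈ directionEdges V i :=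
        mk_mem_directionEdges.2 ⟨by simpa using ha, fun j hj => by simp [hj]⟩
      exact (hz' (Finset.mem_filter.2 ⟨Finset.mem_univ _, hmem⟩)).elim

variable [∀ i, DecidableEq (V i)]

/-- The tensor product of the matrices `completeEigenbasis R (o i)`. -/
def productEigenbasis (R : Type*) [CommRing R] (o : ∀ i, V i) :
    Matrix (∀ i, V i) (∀ i, V i) R :=
  Matrix.of fun x y => ∏ i, completeEigenbasis R (o i) (x i) (y i)

/-- The eigenvalue that belongs to column `y` of `productEigenbasis R o`. -/
def productEigenvalue (q : ι → R) (o y : ∀ i, V i) : R :=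
  ∑ i, if y i = o i then 0 else q i * (Fintype.card (V i) : R)

theorem sum_productEigenbasis (o y : ∀ i, V i) :
    ∑ x, productEigenbasis R o x y = if y = o then (Fintype.card (∀ i, V i) : R) else 0 := by
  simp only [productEigenbasis, Matrix.of_apply]
  rw [← Fintype.piFinset_univ, ← Finset.prod_univ_sum (fun _ => Finset.univ)
    (fun i x => completeEigenbasis R (o i) x (y i))]
  simp only [sum_completeEigenbasis]
  by_cases hy : y = o
  · simp [hy, Fintype.card_pi]
  · obtain ⟨i, hi⟩ := Function.ne_iff.1 hy
    rw [if_neg hy]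
    exact Finset.prod_eq_zero (Finset.mem_univ i) (if_neg hi)

theorem det_productEigenbasis_ne_zero [IsDomain R] [CharZero R] (o : ∀ i, V i) :
    (productEigenbasis R o).det ≠ 0 := by
  let Q : Matrix (∀ i, V i) (∀ i, V i) R :=
    Matrix.of fun x y => ∏ i, completeEigenbasisInv R (o i) (x i) (y i)
  have hQ : Q * productEigenbasis R o =
      (Fintype.card (∀ i, V i) : R) • (1 : Matrix (∀ i, V i) (∀ i, V i) R) := by
    ext y z
    simp only [Q, productEigenbasis, Matrix.mul_apply, Matrix.of_apply, ← Finset.prod_mul_distrib]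
    rw [← Fintype.piFinset_univ, ← Finset.prod_univ_sum (fun _ => Finset.univ)
      (fun i x => completeEigenbasisInv R (o i) (y i) x * completeEigenbasis R (o i) x (z i))]
    simp only [completeEigenbasisInv_mul_apply]
    by_cases hyz : y = z
    · simp [hyz, Fintype.card_pi]
    · obtain ⟨i, hi⟩ := Function.ne_iff.1 hyz
      rw [Finset.prod_eq_zero (Finset.mem_univ i) (if_neg hi)]
      simp [Matrix.one_apply_ne hyz]
  intro h0
  have hdet := congrArg Matrix.det hQ
  rw [Matrix.det_mul, h0, mul_zero, Matrix.det_smul, Matrix.det_one, mul_one] at hdet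
  have : Nonempty (∀ i, V i) := ⟨o⟩
  exact pow_ne_zero _ (Nat.cast_ne_zero.2 Fintype.card_ne_zero) hdet.symm

theorem weightedLaplacian_mul_productEigenbasis (q : ι → R) (o x y : ∀ i, V i) :
    (weightedLaplacian (directionWeight q) * productEigenbasis R o :
      Matrix (∀ i, V i) (∀ i, V i) R) x y =
      productEigenvalue q o y * productEigenbasis R o x y := by
  classical
  have hcol := weightedLaplacian_mulVec (directionWeight q) (fun z => productEigenbasis R o z y) x
  refine Eq.trans hcol ?_
  simp only [directionWeight, Finset.sum_mul, productEigenvalue]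
  rw [Finset.sum_comm]
  refine Finset.sum_congr rfl fun i _ => ?_
  have hdir : (∑ z, (if s(x, z) ∈ directionEdges V i then q i else 0) *
        (productEigenbasis R o x y - productEigenbasis R o z y)) =
      q i * ∑ z, if s(x, z) ∈ directionEdges V i then
        productEigenbasis R o x y - productEigenbasis R o z y else 0 := by
    rw [Finset.mul_sum]
    refine Finset.sum_congr rfl fun z _ => ?_
    split_ifs <;> simp
  rw [hdir, sum_directionEdges i x _ (sub_self _)]
  set c := ∏ j ∈ Finset.univ.erase i, completeEigenbasis R (o j) (x j) (y j) with hc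
  have hx : productEigenbasis R o x y = completeEigenbasis R (o i) (x i) (y i) * c :=
    (Finset.mul_prod_erase _ _ (Finset.mem_univ i)).symm
  have hupd : ∀ a, productEigenbasis R o (Function.update x i a) y =
      completeEigenbasis R (o i) a (y i) * c := by
    intro a
    refine (Finset.mul_prod_erase _ _ (Finset.mem_univ i)).symm.trans ?_
    rw [Function.update_self, hc]
    congr 1
    refine Finset.prod_congr rfl fun j hj => ?_
    rw [Function.update_of_ne (Finset.ne_of_mem_erase hj)]
  simp only [hx, hupd, ← sub_mul, ← Finset.sum_mul, sum_completeEigenbasis_sub]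
  split_ifs <;> ring

theorem det_weightedLaplacian_directionWeight [IsDomain R] [CharZero R] (q : ι → R)
    (o : ∀ i, V i) :
    (weightedLaplacian (directionWeight (V := V) q) + Matrix.of fun _ _ => 1).det =
      (Fintype.card (∀ i, V i) : R) * ∏ y ∈ Finset.univ.erase o, productEigenvalue q o y := by
  let d : (∀ i, V i) → R := fun y =>
    if y = o then (Fintype.card (∀ i, V i) : R) else productEigenvalue q o y
  have hmul : (weightedLaplacian (directionWeight (V := V) q) + Matrix.of fun _ _ => 1) *
      productEigenbasis R o = productEigenbasis R o * Matrix.diagonal d := by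
    ext x y
    have hones : ((Matrix.of fun _ _ => 1) * productEigenbasis R o :
        Matrix (∀ i, V i) (∀ i, V i) R) x y =
        if y = o then (Fintype.card (∀ i, V i) : R) else 0 := by
      simp only [Matrix.mul_apply, Matrix.of_apply, one_mul, sum_productEigenbasis]
    rw [Matrix.add_mul, Matrix.add_apply, weightedLaplacian_mul_productEigenbasis, hones,
      Matrix.mul_diagonal]
    by_cases hy : y = o
    · subst hy
      simp [d, productEigenvalue, productEigenbasis, completeEigenbasis]
    · simp [d, hy, mul_comm]
  have hdet := congrArg Matrix.det hmul
  rw [Matrix.det_mul, Matrix.det_mul, Matrix.det_diagonal, mul_comm] at hdet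
  rw [mul_left_cancel₀ (det_productEigenbasis_ne_zero o) hdet,
    ← Finset.mul_prod_erase _ _ (Finset.mem_univ o)]
  congr 1
  · exact if_pos rfl
  · exact Finset.prod_congr rfl fun y hy => if_neg (Finset.ne_of_mem_erase hy)

/-- Grouping the eigenvalues by the set `A` of coordinates in which `y` differs from `o`. -/
theorem prod_productEigenvalue (q : ι → R) (o : ∀ i, V i) :
    ∏ y ∈ Finset.univ.erase o, productEigenvalue q o y =
      ∏ A : Finset ι with A.Nonempty,
        (∑ i ∈ A, q i * (Fintype.card (V i) : R)) ^ ∏ i ∈ A, (Fintype.card (V i) - 1) := by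
  let supp : (∀ i, V i) → Finset ι := fun y => {i | y i ≠ o i}
  rw [← Finset.prod_fiberwise_of_maps_to (g := supp) (t := {A | A.Nonempty})]
  · refine Finset.prod_congr rfl fun A hA => ?_
    have hfiber : {y ∈ Finset.univ.erase o | supp y = A} =
        Fintype.piFinset fun i => if i ∈ A then Finset.univ.erase (o i) else {o i} := by
      ext y
      simp only [Finset.mem_filter, Finset.mem_erase, Finset.mem_univ, and_true,
        Fintype.mem_piFinset]
      constructor
      · rintro ⟨-, rfl⟩ i
        by_cases hi : y i = o i <;> simp [supp, hi]
      · intro h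
        have hs : supp y = A := by
          ext i
          have := h i
          by_cases hi : i ∈ A <;> simp [hi] at this <;> simp [supp, hi, this]
        refine ⟨?_, hs⟩
        rintro rfl
        have hne := (Finset.mem_filter.1 hA).2
        rw [← hs] at hne
        simp [supp] at hne
    have hcard : ({y ∈ Finset.univ.erase o | supp y = A}).card =
        ∏ i ∈ A, (Fintype.card (V i) - 1) := by
      rw [hfiber, Fintype.card_piFinset, ← Finset.prod_subset (Finset.subset_univ A)]
      · exact Finset.prod_congr rfl fun i hi => by simp [hi]
      · intro i _ hi
        simp [hi]
    rw [← hcard]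
    refine Finset.prod_eq_pow_card fun y hy => ?_
    rw [← (Finset.mem_filter.1 hy).2, Finset.sum_filter]
    exact Finset.sum_congr rfl fun i _ => by by_cases hi : y i = o i <;> simp [hi]
  · intro y hy
    obtain ⟨i, hi⟩ := Function.ne_iff.1 (Finset.ne_of_mem_erase hy)
    exact Finset.mem_filter.2 ⟨Finset.mem_univ _, i, by simpa [supp] using hi⟩

open Classical in
theorem card_mul_sum_edgeWeight [IsDomain R] [CharZero R] [∀ i, Nonempty (V i)] (q : ι → R) :
    (Fintype.card (∀ i, V i) : R) *
        ∑ T : SimpleGraph (∀ i, V i) with T.IsTree, edgeWeight (directionWeight q) T =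
      ∏ A : Finset ι with A.Nonempty,
        (∑ i ∈ A, q i * (Fintype.card (V i) : R)) ^ ∏ i ∈ A, (Fintype.card (V i) - 1) := by
  have hcard : (Fintype.card (∀ i, V i) : R) ≠ 0 := Nat.cast_ne_zero.2 Fintype.card_ne_zero
  apply mul_left_cancel₀ hcard
  rw [← prod_productEigenvalue q fun i => Classical.arbitrary (V i),
    ← det_weightedLaplacian_directionWeight, det_weightedLaplacian_add_one]
  ring

end Product

/-! ### The direction monomial and the two product formulas -/

section DirMonomial

variable {ι : Type*} {V : ι → Type*}

/-- An edge of a subgraph of the product lies in direction `i` exactly when its endpoints differ in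
the `i`-th coordinate. -/
theorem mem_directionEdges_iff {T : SimpleGraph (∀ i, V i)}
    (hT : T ≤ cartesianProduct fun i => SimpleGraph.completeGraph (V i)) {e : Sym2 (∀ i, V i)}
    (he : e ∈ T.edgeSet) (i : ι) :
    e ∈ directionEdges V i ↔ ∃ x y : ∀ i, V i, e = s(x, y) ∧ x i ≠ y i := by
  constructor
  · rintro ⟨x, y, h, h1, -⟩
    exact ⟨x, y, h, h1⟩
  · rintro ⟨x, y, rfl, h1⟩
    obtain ⟨j, -, hj⟩ := hT ((SimpleGraph.mem_edgeSet _).1 he)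
    by_cases hij : i = j
    · subst hij
      exact mk_mem_directionEdges.2 ⟨h1, hj⟩
    · exact absurd (hj i hij) h1

theorem exists_mem_directionEdges {x y : ∀ i, V i}
    (h : (cartesianProduct fun i => SimpleGraph.completeGraph (V i)).Adj x y) :
    ∃ i, s(x, y) ∈ directionEdges V i :=
  h.imp fun _ hi => mk_mem_directionEdges.2 ⟨hi.1, hi.2⟩

theorem eq_of_mem_directionEdges {e : Sym2 (∀ i, V i)} {i j : ι}
    (hi : e ∈ directionEdges V i) (hj : e ∈ directionEdges V j) : i = j := by
  obtain ⟨x, y, rfl, hxy, -⟩ := hi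
  by_contra hij
  exact hxy ((mk_mem_directionEdges.1 hj).2 i hij)

variable [Fintype ι]

theorem directionWeight_eq_of_mem {R : Type*} [CommRing R] (q : ι → R) {e : Sym2 (∀ i, V i)} {i : ι}
    (hi : e ∈ directionEdges V i) : directionWeight q e = q i := by
  classical
  unfold directionWeight
  rw [Finset.sum_eq_single i (fun j _ hj => if_neg fun h => hj (eq_of_mem_directionEdges h hi))
    (fun h => absurd (Finset.mem_univ i) h), if_pos hi]

variable [DecidableEq ι] [∀ i, Fintype (V i)]

theorem edgeWeight_eq_dirMonomial {T : SimpleGraph (∀ i, V i)}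
    (hT : T ≤ cartesianProduct fun i => SimpleGraph.completeGraph (V i)) :
    edgeWeight (directionWeight (X : ι → MvPolynomial ι ℚ)) T = dirMonomial T := by
  classical
  have hfactor : ∀ i, (X i : MvPolynomial ι ℚ) ^ dirCount T i =
      ∏ e : Sym2 (∀ i, V i) with e ∈ T.edgeSet, if e ∈ directionEdges V i then X i else 1 := by
    intro i
    rw [← Finset.prod_filter, Finset.prod_const, dirCount, ← Set.ncard_coe_finset]
    congr 2
    ext e
    simp only [Set.mem_ofPred_eq, Finset.coe_filter, Finset.mem_filter, Finset.mem_univ, true_and]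
    exact and_congr_right fun he => (mem_directionEdges_iff hT he i).symm
  rw [dirMonomial, Finset.prod_congr rfl fun i _ => hfactor i, Finset.prod_comm, edgeWeight]
  refine Finset.prod_congr (by congr) fun e he => ?_
  obtain ⟨i, hi⟩ : ∃ i, e ∈ directionEdges V i := by
    have he' : e ∈ T.edgeSet := (Finset.mem_filter.1 he).2
    induction e with
    | _ x y => exact exists_mem_directionEdges (hT he')
  rw [directionWeight_eq_of_mem _ hi, Finset.prod_eq_single i
    (fun j _ hj => if_neg fun h => hj (eq_of_mem_directionEdges h hi))
    (fun h => absurd (Finset.mem_univ i) h), if_pos hi]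

/-- A tree that uses a pair of vertices which is not an edge of the product has weight zero. -/
theorem edgeWeight_eq_zero_of_not_le {R : Type*} [CommRing R] (q : ι → R)
    {T : SimpleGraph (∀ i, V i)}
    (hT : ¬ T ≤ cartesianProduct fun i => SimpleGraph.completeGraph (V i)) :
    edgeWeight (directionWeight q) T = 0 := by
  classical
  obtain ⟨x, y, hxy, hnot⟩ : ∃ x y, T.Adj x y ∧
      ¬ (cartesianProduct fun i => SimpleGraph.completeGraph (V i)).Adj x y := by
    by_contra! h
    exact hT fun x y hxy => h x y hxy
  refine Finset.prod_eq_zero (i := s(x, y))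
    (Finset.mem_filter.2 ⟨Finset.mem_univ _, hxy⟩) ?_
  refine Finset.sum_eq_zero fun i _ => if_neg fun h => hnot ⟨i, ?_⟩
  exact mk_mem_directionEdges.1 h

open Classical in
theorem sum_spanningTrees_dirMonomial [∀ i, DecidableEq (V i)] :
    ∑ T ∈ spanningTrees (cartesianProduct fun i => SimpleGraph.completeGraph (V i)),
        dirMonomial T =
      ∑ T : SimpleGraph (∀ i, V i) with T.IsTree,
        edgeWeight (directionWeight (X : ι → MvPolynomial ι ℚ)) T := by
  have hmem : ∀ T, T ∈ spanningTrees (cartesianProduct fun i => SimpleGraph.completeGraph (V i)) ↔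
      T ≤ (cartesianProduct fun i => SimpleGraph.completeGraph (V i)) ∧ T.IsTree := fun T => by
    simp [spanningTrees]
  rw [Finset.sum_congr rfl fun T hT => (edgeWeight_eq_dirMonomial ((hmem T).1 hT).1).symm]
  refine Finset.sum_subset (fun T hT => by simpa using ((hmem T).1 hT).2) fun T hT hT' => ?_
  exact edgeWeight_eq_zero_of_not_le _ fun hle =>
    hT' ((hmem T).2 ⟨hle, (Finset.mem_filter.1 hT).2⟩)

end DirMonomial

/-- Splitting off the factors of the singletons `A = {i}`. -/
theorem prod_nonempty_eq_prod_mul_prod_two_le_card {ι M : Type*} [Fintype ι] [DecidableEq ι]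
    [CommMonoid M] (F : Finset ι → M) :
    ∏ A : Finset ι with A.Nonempty, F A =
      (∏ i, F {i}) * ∏ A : Finset ι with 2 ≤ A.card, F A := by
  rw [← Finset.prod_filter_mul_prod_filter_not _ fun A : Finset ι => A.card = 1]
  congr 1
  · rw [Finset.filter_filter]
    refine Eq.trans ?_ (Finset.prod_map Finset.univ ⟨_, Finset.singleton_injective⟩ F)
    refine Finset.prod_congr ?_ fun _ _ => rfl
    ext A
    simp only [Finset.mem_filter, Finset.mem_univ, true_and, Finset.mem_map,
      Function.Embedding.coeFn_mk, Finset.card_eq_one]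
    constructor
    · rintro ⟨-, i, rfl⟩
      exact ⟨i, rfl⟩
    · rintro ⟨i, rfl⟩
      exact ⟨Finset.singleton_nonempty i, i, rfl⟩
  · rw [Finset.filter_filter]
    refine Finset.prod_congr ?_ fun _ _ => rfl
    ext A
    simp only [Finset.mem_filter, Finset.mem_univ, true_and, ← Finset.card_pos]
    omega

theorem theorem1p1 (r : ℕ) (n : Fin r → ℕ) (hn : ∀ i, 1 ≤ n i) :
    (∑ T ∈ spanningTrees (cartesianProduct fun i : Fin r => SimpleGraph.completeGraph (Fin (n i))),
        dirMonomial T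
      = C (1 / ∏ i, (n i : ℚ)) *
          ∏ A : Finset (Fin r) with A.Nonempty,
            (∑ i ∈ A, X i * C (n i : ℚ)) ^ (∏ i ∈ A, (n i - 1))) ∧
    (∑ T ∈ spanningTrees (cartesianProduct fun i : Fin r => SimpleGraph.completeGraph (Fin (n i))),
        dirMonomial T
      = (∏ i, (X i ^ (n i - 1) * C ((n i : ℚ) ^ ((n i : ℤ) - 2)))) *
          ∏ A : Finset (Fin r) with 2 ≤ A.card,
            (∑ i ∈ A, X i * C (n i : ℚ)) ^ (∏ i ∈ A, (n i - 1))) := by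
  classical
  have hn0 : ∀ i, (n i : ℚ) ≠ 0 := fun i => Nat.cast_ne_zero.2 (by have := hn i; omega)
  have : ∀ i, Nonempty (Fin (n i)) := fun i => ⟨⟨0, hn i⟩⟩
  have hfirst : ∑ T ∈ spanningTrees
        (cartesianProduct fun i : Fin r => SimpleGraph.completeGraph (Fin (n i))), dirMonomial T
      = C (1 / ∏ i, (n i : ℚ)) *
          ∏ A : Finset (Fin r) with A.Nonempty,
            (∑ i ∈ A, X i * C (n i : ℚ)) ^ (∏ i ∈ A, (n i - 1)) := by
    have hmain := card_mul_sum_edgeWeight (V := fun i : Fin r => Fin (n i))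
      (X : Fin r → MvPolynomial (Fin r) ℚ)
    simp only [Fintype.card_fin] at hmain
    rw [← sum_spanningTrees_dirMonomial (V := fun i : Fin r => Fin (n i))] at hmain
    have hcard : ((Fintype.card (∀ i : Fin r, Fin (n i)) : ℕ) : MvPolynomial (Fin r) ℚ) =
        C (∏ i, (n i : ℚ)) := by
      simp [Fintype.card_pi]
    simp only [map_natCast] at hmain ⊢
    rw [← hmain, hcard, ← mul_assoc, ← C_mul,
      one_div_mul_cancel (Finset.prod_ne_zero_iff.2 fun i _ => hn0 i), C_1, one_mul]
  refine ⟨hfirst, ?_⟩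
  rw [hfirst, prod_nonempty_eq_prod_mul_prod_two_le_card, ← mul_assoc]
  congr 1
  simp only [Finset.sum_singleton, Finset.prod_singleton, mul_pow]
  rw [← Finset.prod_const_one, ← Finset.prod_div_distrib, map_prod, ← Finset.prod_mul_distrib]
  refine Finset.prod_congr rfl fun i _ => ?_
  have hpow : (n i : ℚ) ^ ((n i : ℤ) - 2) = 1 / (n i : ℚ) * (n i : ℚ) ^ (n i - 1) := by
    have hexp : (n i : ℤ) - 2 = ((n i - 1 : ℕ) : ℤ) - 1 := by
      have := hn i
      omega
    rw [hexp, zpow_sub_one₀ (hn0 i), zpow_natCast]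
    ring
  rw [hpow, C_mul, C_pow]
  ring
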